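/- Let $G$ be a group. For a subset $A\subseteq G$ let $\mathrm{cov}(A)=\min\{|F| : F\subseteq G,\ G=FA\}$ be its covering number, with $\mathrm{cov}(\emptyset)=\infty$, where $\infty$ is larger than every cardinal. Then for every partition $G=A_1\cup\dots\cup A_n$ of $G$ into $n$ pairwise disjoint (possibly empty) cells, at least one of the following holds: $\mathrm{cov}(A_iA_i^{-1})\le n$ for all $i\in\{1,\dots,n\}$, or $\mathrm{cov}(A_iA_i^{-1}A_i)<n$ for some $i\in\{1,\dots,n\}$. -/

import Mathlib

open scoped Pointwise

universe u

/-- The covering number `cov(A) = min {|F| : F ⊆ G, G = F A}` of a subset `A` of a group `G`.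
It takes values in the cardinals with a largest element `∞ = ⊤` adjoined; the infimum over the
(well-ordered) cardinals is a minimum when some `F` exists, and it is `∞` when there is none,
that is, when `A` is empty. -/
noncomputable def cov {G : Type u} [Group G] (A : Set G) : WithTop Cardinal.{u} :=
  ⨅ (F : Set G) (_ : F * A = Set.univ), ((Cardinal.mk F : Cardinal.{u}) : WithTop Cardinal.{u})

/-! Suppose no `A i * (A i)⁻¹ * A i` has covering number below `n`. Then some finitely additive mean
gives every left translate of every cell mass at most `1 / n + ε`. The translates of the cells by a
fixed `x` partition `G`, so each mass is also nearly at least `1 / n`, hence above `1 / (n + 1)`.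
Thus at most `n` translates of a cell are disjoint, and a maximal disjoint family gives the cover
(`exists_cover_of_packing`).

No invariant mean need exist. Instead, `exists_conv_prob_le` lowers the largest mass of a translate
of one cell by left convolution: at a near-minimum, averaging the mean with a twisted convolution
square of itself would lower it further. -/

/-- A mean on `G`: a positive unital linear functional on the real functions on `G`. -/
structure Mean (G : Type u) where
  toFun : (G → ℝ) →ₗ[ℝ] ℝ
  nonneg : ∀ f : G → ℝ, 0 ≤ f → 0 ≤ toFun f
  map_one : toFun 1 = 1

namespace Mean

variable {G : Type u}

theorem mono (μ : Mean G) {f g : G → ℝ} (h : f ≤ g) : μ.toFun f ≤ μ.toFun g := by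
  have := μ.nonneg (g - f) (sub_nonneg.2 h)
  rw [map_sub] at this
  linarith

theorem map_const (μ : Mean G) (c : ℝ) : μ.toFun (fun _ => c) = c := by
  have : (fun _ : G => c) = c • (1 : G → ℝ) := by ext; simp
  rw [this, map_smul, μ.map_one, smul_eq_mul, mul_one]

/-- The finitely additive probability of a set. -/
noncomputable def prob (μ : Mean G) (s : Set G) : ℝ := μ.toFun (s.indicator 1)

theorem prob_nonneg (μ : Mean G) (s : Set G) : 0 ≤ μ.prob s :=
  μ.nonneg _ (Set.indicator_nonneg fun _ _ => zero_le_one)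

theorem prob_le_one (μ : Mean G) (s : Set G) : μ.prob s ≤ 1 := by
  rw [← μ.map_one]
  exact μ.mono (Set.indicator_le_self' fun _ _ => zero_le_one)

theorem prob_univ (μ : Mean G) : μ.prob Set.univ = 1 := by
  rw [prob, Set.indicator_univ, μ.map_one]

theorem prob_empty (μ : Mean G) : μ.prob ∅ = 0 := by
  rw [prob, Set.indicator_empty', map_zero]

theorem prob_biUnion (μ : Mean G) {ι : Type*} (F : Finset ι) (s : ι → Set G)
    (h : (F : Set ι).PairwiseDisjoint s) : μ.prob (⋃ i ∈ F, s i) = ∑ i ∈ F, μ.prob (s i) := by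
  simp only [prob]
  rw [← map_sum]
  congr 1
  ext x
  rw [Finset.indicator_biUnion F s h, Finset.sum_apply]

theorem card_mul_le_one (μ : Mean G) {ι : Type*} (F : Finset ι) (s : ι → Set G)
    (h : (F : Set ι).PairwiseDisjoint s) {c : ℝ} (hc : ∀ i ∈ F, c ≤ μ.prob (s i)) :
    F.card * c ≤ 1 := by
  calc F.card * c = ∑ _i ∈ F, c := by rw [Finset.sum_const, nsmul_eq_mul]
    _ ≤ ∑ i ∈ F, μ.prob (s i) := Finset.sum_le_sum hc
    _ = μ.prob (⋃ i ∈ F, s i) := (μ.prob_biUnion F s h).symm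
    _ ≤ 1 := μ.prob_le_one _

/-- The Dirac mean at a point. -/
def dirac (g : G) : Mean G where
  toFun := LinearMap.proj g
  nonneg _ hf := hf g
  map_one := rfl

/-- The midpoint of two means. -/
noncomputable def mid (μ ν : Mean G) : Mean G where
  toFun := (1 / 2 : ℝ) • (μ.toFun + ν.toFun)
  nonneg f hf := by
    have h₁ := μ.nonneg f hf
    have h₂ := ν.nonneg f hf
    simp only [LinearMap.smul_apply, LinearMap.add_apply, smul_eq_mul]
    positivity
  map_one := by
    simp only [LinearMap.smul_apply, LinearMap.add_apply, smul_eq_mul, μ.map_one, ν.map_one]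
    norm_num

variable [Group G]

/-- The convolution of two means. -/
def conv (ν μ : Mean G) : Mean G where
  toFun :=
    { toFun := fun f => ν.toFun fun t => μ.toFun fun s => f (t * s)
      map_add' := fun f g => by
        rw [← map_add]
        congr 1
        ext t
        rw [Pi.add_apply, ← map_add]
        rfl
      map_smul' := fun c f => by
        rw [← map_smul]
        congr 1
        ext t
        rw [Pi.smul_apply, RingHom.id_apply, ← map_smul]
        rfl }
  nonneg f hf := ν.nonneg _ fun t => μ.nonneg _ fun s => hf (t * s)
  map_one := by
    change ν.toFun (fun t => μ.toFun 1) = 1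
    rw [μ.map_one, ν.map_const]

theorem conv_assoc (κ ν μ : Mean G) : (κ.conv ν).conv μ = κ.conv (ν.conv μ) := by
  simp only [conv, LinearMap.coe_mk, AddHom.coe_mk, mul_assoc]

theorem prob_conv (ν μ : Mean G) (x : G) (A : Set G) :
    (ν.conv μ).prob (x • A) = ν.toFun fun t => μ.prob ((t⁻¹ * x) • A) := by
  change (ν.toFun fun t => μ.toFun fun s => (x • A).indicator 1 (t * s)) = _
  congr 1
  ext t
  rw [prob]
  congr 1
  ext s
  have : t * s ∈ x • A ↔ s ∈ (t⁻¹ * x) • A := by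
    simp [Set.mem_smul_set_iff_inv_smul_mem, mul_assoc]
  by_cases h : s ∈ (t⁻¹ * x) • A
  · rw [Set.indicator_of_mem h, Set.indicator_of_mem (this.2 h)]; rfl
  · rw [Set.indicator_of_notMem h, Set.indicator_of_notMem (mt this.1 h)]

/-- Left convolution averages the masses of left translates, so a uniform bound already won for one
cell survives the treatment of the others. -/
theorem prob_conv_le (ν μ : Mean G) (A : Set G) {c : ℝ} (h : ∀ x : G, μ.prob (x • A) ≤ c)
    (x : G) : (ν.conv μ).prob (x • A) ≤ c := by
  rw [prob_conv, ← ν.map_const c]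
  exact ν.mono fun t => by simpa only [ν.map_const] using h (t⁻¹ * x)

end Mean

/-! ### Packing, covering and the averaging argument -/

section Covering

variable {G : Type u} [Group G]

theorem cov_le_natCast {A : Set G} (F : Finset G) {n : ℕ} (hn : F.card ≤ n)
    (h : (F : Set G) * A = Set.univ) : cov A ≤ (n : WithTop Cardinal.{u}) := by
  refine (iInf₂_le (F : Set G) h).trans ?_
  rw [← WithTop.coe_natCast, WithTop.coe_le_coe]
  simpa using hn

theorem cov_lt_natCast {A : Set G} (F : Finset G) {n : ℕ} (hn : F.card < n)
    (h : (F : Set G) * A = Set.univ) : cov A < (n : WithTop Cardinal.{u}) := by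
  refine (iInf₂_le (F : Set G) h).trans_lt ?_
  rw [← WithTop.coe_natCast, WithTop.coe_lt_coe]
  simpa using hn

/-- A maximal family of disjoint translates of `A` by elements of `B` yields a cover of `B`
by translates of `A * A⁻¹`. -/
theorem exists_cover_of_packing {A B : Set G} (hA : A.Nonempty) (k : ℕ)
    (h : ∀ F : Finset G, (F : Set G) ⊆ B → (F : Set G).PairwiseDisjoint (fun x => x • A) →
      F.card ≤ k) :
    ∃ F : Finset G, F.card ≤ k ∧ B ⊆ (F : Set G) * (A * A⁻¹) := by
  classical
  let P : ℕ → Prop := fun m => ∃ F : Finset G, (F : Set G) ⊆ B ∧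
    (F : Set G).PairwiseDisjoint (fun x => x • A) ∧ F.card = m
  have hP0 : P 0 := ⟨∅, by simp, by simp, rfl⟩
  -- A packing of largest size is maximal, so any further translate meets one of its members.
  obtain ⟨F, hFB, hFd, hFc⟩ : P (Nat.findGreatest P k) := Nat.findGreatest_spec (Nat.zero_le k) hP0
  refine ⟨F, h F hFB hFd, fun x hx => ?_⟩
  by_contra hxF
  have hmeet : ∀ y ∈ F, Disjoint (x • A) (y • A) := by
    intro y hy
    rw [Set.disjoint_left]
    rintro _ ⟨a, ha, rfl⟩ ⟨b, hb, hab⟩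
    refine hxF ⟨y, hy, b * a⁻¹, ⟨b, hb, a⁻¹, Set.inv_mem_inv.2 ha, rfl⟩, ?_⟩
    simp only [smul_eq_mul] at hab
    change y * (b * a⁻¹) = x
    rw [← mul_assoc, hab, mul_inv_cancel_right]
  have hxn : x ∉ F := fun hxm => by
    have := hmeet x hxm
    rw [disjoint_self] at this
    exact (hA.smul_set (a := x)).ne_empty this
  have hsub : ((insert x F : Finset G) : Set G) ⊆ B := by
    rw [Finset.coe_insert]
    exact Set.insert_subset hx hFB
  have hdis : ((insert x F : Finset G) : Set G).PairwiseDisjoint (fun x => x • A) := by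
    rw [Finset.coe_insert]
    exact hFd.insert fun y hy _ => hmeet y hy
  have hle := h _ hsub hdis
  have := Nat.le_findGreatest (P := P) hle ⟨_, hsub, hdis, rfl⟩
  rw [Finset.card_insert_of_notMem hxn] at this
  omega

/-- If fewer than `n` translates of `A * A⁻¹ * A` do not cover the group, then for each mean `μ`
some element of the group is not reached from the translates of `A` of mass above `1 / n`. -/
theorem exists_forall_prob_le {n : ℕ} (hn : 0 < n) {A : Set G} (hA : A.Nonempty)
    (hcov : ¬ cov (A * A⁻¹ * A) < (n : WithTop Cardinal.{u})) (μ : Mean G) :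
    ∃ h : G, ∀ a ∈ A, μ.prob ((h * a⁻¹) • A) ≤ 1 / n := by
  by_contra! hne
  have hn' : (0 : ℝ) < n := by exact_mod_cast hn
  obtain ⟨F, hFc, hF⟩ := exists_cover_of_packing (B := {x | 1 / (n : ℝ) < μ.prob (x • A)}) hA
    (n - 1) (fun F hFB hFd => by
      rcases F.eq_empty_or_nonempty with rfl | hFne
      · simp
      -- Comparing with the least mass keeps the inequality strict, which yields `n - 1` rather than
      -- `n`.
      obtain ⟨y, hy, hmin⟩ := F.exists_min_image (fun x => μ.prob (x • A)) hFne
      have h₁ := μ.card_mul_le_one F _ hFd (c := μ.prob (y • A)) hmin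
      have h₂ : 1 / (n : ℝ) < μ.prob (y • A) := hFB hy
      have h₃ : (0 : ℝ) < F.card := by exact_mod_cast hFne.card_pos
      have h₄ : (F.card : ℝ) * (1 / n) < 1 := (mul_lt_mul_of_pos_left h₂ h₃).trans_le h₁
      rw [mul_one_div, div_lt_one hn'] at h₄
      have : F.card < n := by exact_mod_cast h₄
      omega)
  refine hcov (cov_lt_natCast F (by omega) (Set.eq_univ_of_forall fun g => ?_))
  obtain ⟨a, ha, hga⟩ := hne g
  obtain ⟨y, hy, z, hz, hyz⟩ := hF hga
  refine ⟨y, hy, z * a, ⟨z, hz, a, ha, rfl⟩, ?_⟩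
  change y * z = g * a⁻¹ at hyz
  change y * (z * a) = g
  rw [← mul_assoc, hyz, inv_mul_cancel_right]

/-- If fewer than `n` translates of `A * A⁻¹ * A` do not cover the group, then every mean can be
averaged so that all left translates of `A` have mass at most `1 / n`, up to `ε`. -/
theorem exists_conv_prob_le {n : ℕ} (hn : 0 < n) {A : Set G}
    (hcov : ¬ cov (A * A⁻¹ * A) < (n : WithTop Cardinal.{u})) (μ : Mean G) {ε : ℝ} (hε : 0 < ε) :
    ∃ ν : Mean G, ∀ x : G, (ν.conv μ).prob (x • A) ≤ 1 / n + ε := by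
  by_contra! hne
  have hn' : (0 : ℝ) < 1 / n := by positivity
  have hA : A.Nonempty := by
    rw [Set.nonempty_iff_ne_empty]
    rintro rfl
    obtain ⟨x, hx⟩ := hne μ
    rw [Set.smul_set_empty, Mean.prob_empty] at hx
    linarith
  have hbdd : ∀ κ : Mean G, BddAbove (Set.range fun x : G => κ.prob (x • A)) := fun κ =>
    ⟨1, by rintro _ ⟨x, rfl⟩; exact κ.prob_le_one _⟩
  set Φ : Mean G → ℝ := fun ν => ⨆ x : G, (ν.conv μ).prob (x • A) with hΦ
  have hΦε : ∀ ν, 1 / n + ε ≤ Φ ν := fun ν => by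
    obtain ⟨x, hx⟩ := hne ν
    exact hx.le.trans (le_ciSup (hbdd (ν.conv μ)) x)
  have : Nonempty (Mean G) := ⟨μ⟩
  set v : ℝ := ⨅ ν, Φ ν with hv
  have hvε : 1 / n + ε ≤ v := le_ciInf hΦε
  have hΦb : BddBelow (Set.range Φ) := ⟨_, by rintro _ ⟨ν, rfl⟩; exact hΦε ν⟩
  have hv1 : v ≤ 1 := (ciInf_le hΦb μ).trans (ciSup_le fun x => Mean.prob_le_one _ _)
  set δ : ℝ := ε ^ 2 / 8 with hδ
  have hδ0 : 0 < δ := by positivity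
  obtain ⟨ν, hν⟩ := exists_lt_of_ciInf_lt (show ⨅ ν, Φ ν < v + δ by linarith)
  set κ := ν.conv μ with hκ
  have hup : ∀ x : G, κ.prob (x • A) ≤ v + δ := fun x => (le_ciSup (hbdd κ) x).trans hν.le
  obtain ⟨h, hh⟩ := exists_forall_prob_le hn hA hcov κ
  -- If `κ.prob (x • A)` is well below `v`, the Dirac half keeps the average low; if it is near `v`,
  -- the other half is low, because its integrand is at most `1 / n` on `x • A`.
  set ρ := (Mean.dirac (1 : G)).mid (κ.conv (Mean.dirac h⁻¹)) with hρ
  obtain ⟨x, hx⟩ : ∃ x : G, v - δ < (ρ.conv κ).prob (x • A) := by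
    have : v - δ < Φ (ρ.conv ν) := by linarith [ciInf_le hΦb (ρ.conv ν)]
    rw [hΦ] at this
    simp only [Mean.conv_assoc] at this
    exact exists_lt_of_lt_ciSup this
  have hsplit : (ρ.conv κ).prob (x • A) =
      1 / 2 * (κ.prob (x • A) + κ.toFun fun s => κ.prob ((h * s⁻¹ * x) • A)) := by
    rw [Mean.prob_conv]
    change 1 / 2 * (κ.prob (((1 : G)⁻¹ * x) • A) +
      κ.toFun fun s => κ.prob (((s * h⁻¹)⁻¹ * x) • A)) = _
    simp
  have hbound : (κ.toFun fun s => κ.prob ((h * s⁻¹ * x) • A)) ≤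
      (v + δ) - (v + δ - 1 / n) * κ.prob (x • A) := by
    have hlin : (v + δ) - (v + δ - 1 / n) * κ.prob (x • A) =
        κ.toFun ((fun _ => v + δ) - (v + δ - 1 / n) • (x • A).indicator 1) := by
      rw [map_sub, map_smul, κ.map_const]
      rfl
    rw [hlin]
    refine κ.mono fun s => ?_
    simp only [Pi.sub_apply, Pi.smul_apply, smul_eq_mul]
    by_cases hs : s ∈ x • A
    · rw [Set.indicator_of_mem hs]
      -- Writing `s = x * a` with `a ∈ A` turns `h * s⁻¹ * x` into `h * a⁻¹`, where `h` bounds the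
      -- mass.
      have := hh (x⁻¹ * s) (by simpa [Set.mem_smul_set_iff_inv_smul_mem] using hs)
      rw [mul_inv_rev, inv_inv, ← mul_assoc] at this
      simp only [Pi.one_apply]
      linarith
    · rw [Set.indicator_of_notMem hs]
      linarith [hup (h * s⁻¹ * x)]
  have hf := hup x
  rw [hsplit] at hx
  have hlow : v - 3 * δ < κ.prob (x • A) := by
    have : (κ.toFun fun s => κ.prob ((h * s⁻¹ * x) • A)) ≤ v + δ := by
      rw [← κ.map_const (v + δ)]
      exact κ.mono fun s => by simpa only [κ.map_const] using hup _
    linarith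
  have hε1 : ε ≤ 1 := by linarith
  have hδε : 8 * δ ≤ ε := by rw [hδ]; nlinarith
  -- Both halves exceed `v - 3 * δ`, so the loss is below `4 * δ`; yet it is at least `ε * (ε - 3 *
  -- δ) ≥ 5 * δ`, as `ε ^ 2 = 8 * δ` and `ε ≤ 1`.
  have h₁ : (v + δ - 1 / n) * κ.prob (x • A) < 4 * δ := by linarith
  have h₂ : ε * (ε - 3 * δ) ≤ (v + δ - 1 / n) * κ.prob (x • A) :=
    mul_le_mul (by linarith) (by linarith) (by linarith) (by linarith)
  have h₃ : ε ^ 2 = 8 * δ := by rw [hδ]; ring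
  nlinarith

/-- Cells are treated one at a time; each new convolution preserves the earlier bounds. -/
theorem exists_forall_mem_prob_le {n : ℕ} (hn : 0 < n) {ι : Type*} (A : ι → Set G)
    (hcov : ∀ i, ¬ cov (A i * (A i)⁻¹ * A i) < (n : WithTop Cardinal.{u})) {ε : ℝ} (hε : 0 < ε)
    (I : Finset ι) : ∃ μ : Mean G, ∀ i ∈ I, ∀ x : G, μ.prob (x • A i) ≤ 1 / n + ε := by
  classical
  induction I using Finset.induction_on with
  | empty => exact ⟨Mean.dirac 1, by simp⟩
  | insert i I _ ih =>
    obtain ⟨μ, hμ⟩ := ih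
    obtain ⟨ν, hν⟩ := exists_conv_prob_le hn (hcov i) μ hε
    refine ⟨ν.conv μ, fun j hj => ?_⟩
    rcases Finset.mem_insert.1 hj with rfl | hj
    · exact hν
    · exact ν.prob_conv_le μ (A j) (hμ j hj)

end Covering

theorem corollary2 {G : Type u} [Group G] (n : ℕ) (A : Fin n → Set G)
    (hdisj : Pairwise fun i j => Disjoint (A i) (A j))
    (hcover : (⋃ i, A i) = Set.univ) :
    (∀ i, cov (A i * (A i)⁻¹) ≤ (n : WithTop Cardinal.{u})) ∨
      ∃ i, cov (A i * (A i)⁻¹ * A i) < (n : WithTop Cardinal.{u}) := by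
  classical
  refine or_iff_not_imp_right.2 fun hcov i => ?_
  push Not at hcov
  have hn : 0 < n := i.pos
  have hn' : (0 : ℝ) < n := by exact_mod_cast hn
  -- Chosen so that `n + 1` times the lower bound `1 / n - n * ε` exceeds `1`, which rules out `n +
  -- 1` disjoint translates.
  set ε : ℝ := 1 / (2 * n ^ 2 * (n + 1)) with hε
  obtain ⟨μ, hμ⟩ := exists_forall_mem_prob_le hn A (fun j => not_lt.2 (hcov j))
    (show 0 < ε by positivity) Finset.univ
  have hlow : ∀ x : G, 1 / n - n * ε ≤ μ.prob (x • A i) := fun x => by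
    have htotal : ∑ j, μ.prob (x • A j) = 1 := by
      rw [← μ.prob_biUnion Finset.univ (fun j => x • A j)
        (fun j _ k _ hjk => Set.disjoint_smul_set.2 (hdisj hjk)), ← μ.prob_univ]
      congr 1
      simp only [Finset.mem_univ, Set.iUnion_true]
      rw [← Set.smul_set_iUnion, hcover, Set.smul_set_univ]
    rw [← Finset.add_sum_erase _ _ (Finset.mem_univ i)] at htotal
    have hrest : ∑ j ∈ Finset.univ.erase i, μ.prob (x • A j) ≤ (n - 1) * (1 / n + ε) := by
      refine (Finset.sum_le_card_nsmul _ _ _ fun j _ => hμ j (Finset.mem_univ j) x).trans_eq ?_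
      rw [Finset.card_erase_of_mem (Finset.mem_univ i), Finset.card_univ, Fintype.card_fin,
        nsmul_eq_mul, Nat.cast_sub hn, Nat.cast_one]
    have : (n : ℝ) * (1 / n) = 1 := by field_simp
    have : 0 < ε := by positivity
    nlinarith
  have hlow_eq : ((n : ℝ) + 1) * (1 / n - n * ε) = 1 + 1 / (2 * n) := by
    rw [hε]
    field_simp
    ring
  have hpos : 0 < 1 / n - n * ε := by
    refine pos_of_mul_pos_right (a := (n : ℝ) + 1) ?_ (by positivity)
    rw [hlow_eq]
    positivity
  have hA : (A i).Nonempty := by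
    rw [Set.nonempty_iff_ne_empty]
    intro h
    have := hlow 1
    rw [h, Set.smul_set_empty, μ.prob_empty] at this
    linarith
  obtain ⟨F, hFc, hF⟩ := exists_cover_of_packing (B := Set.univ) hA n (fun F _ hFd => by
    have h₁ := μ.card_mul_le_one F _ hFd (fun x _ => hlow x)
    by_contra! hlt
    have h₂ : (n : ℝ) + 1 ≤ F.card := by exact_mod_cast hlt
    have h₃ := mul_le_mul_of_nonneg_right h₂ hpos.le
    have h₄ : 0 < 1 / (2 * (n : ℝ)) := by positivity
    linarith)
  exact cov_le_natCast F hFc (Set.univ_subset_iff.1 hF)
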